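/- Let $Q$ and $Q'$ be quantum systems with finite-dimensional Hilbert spaces $\mathcal H_Q$, $\mathcal H_{Q'}$, let $\omega$ be a fixed density matrix on $\mathcal H_Q$ and $\omega'$ a fixed density matrix on $\mathcal H_{Q'}$ (their Gibbs states; for $Q=Q'$ one takes $\omega'=\omega$). Let $\rho$ be a density matrix on $\mathcal H_Q$ and $\sigma$ a density matrix on $\mathcal H_{Q'}$ with $[\sigma,\omega']=0$. For a pair $(\rho_0,\rho_1)$ of density matrices on a space $\mathcal H_B$, a finite set $U$ and a probability distribution $p$ on $U\times\{0,1\}$, let $\rho_{UB}=\sum_{u\in U}\sum_{x\in\{0,1\}}p(u,x)\,|u\rangle\langle u|\otimes\rho_x$, and let $H_{\min}(U|B)_\rho=\sup\{h\in\mathbb R:\ \rho_{UB}\le 2^{-h}\,\mathbb 1_U\otimes\tau\text{ for some density matrix }\tau\text{ on }\mathcal H_B\}$ be its conditional min-entropy. Write $\rho\succeq_\omega\sigma$ if, for every finite set $U$ and every probability distribution $p$ on $U\times\{0,1\}$, the state $\rho_{UQ}$ built from the pair $(\rho_0,\rho_1)=(\rho,\omega)$ and the state $\sigma_{UQ'}$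 built from the pair $(\sigma_0,\sigma_1)=(\sigma,\omega')$ satisfy $H_{\min}(U|Q)_\rho\le H_{\min}(U|Q')_\sigma$. Then there exists a Gibbs-preserving transition from $\rho$ to $\sigma$, that is, a completely positive trace-preserving linear map $\Phi:\mathrm L(\mathcal H_Q)\to \mathrm L(\mathcal H_{Q'})$ with $\Phi(\rho)=\sigma$ and $\Phi(\omega)=\omega'$, if and only if $\rho\succeq_\omega\sigma$. -/

import Mathlib

open scoped Matrix Kronecker ComplexOrder MatrixOrder Matrix.Norms.L2Operator CStarAlgebra

/-- `ρ` is a density matrix on the Hilbert space `ℂⁿ`: positive semidefinite with unit trace. -/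
def IsDensityMatrix {n : Type*} [Fintype n] (ρ : Matrix n n ℂ) : Prop :=
  ρ.PosSemidef ∧ ρ.trace = 1

/-- The completely positive map `Φ` preserves the trace, so that it is a quantum channel
(a CPTP linear map). -/
def IsTracePreserving {n m : Type*} [Fintype n] [DecidableEq n] [Fintype m] [DecidableEq m]
    (Φ : Matrix n n ℂ →CP Matrix m m ℂ) : Prop :=
  ∀ X : Matrix n n ℂ, (Φ X).trace = X.trace

/-- `p` is a (joint) probability distribution on the finite set `U × {0, 1}`. -/
def IsJointDistribution {U : Type*} [Fintype U] (p : U → Fin 2 → ℝ) : Prop :=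
  (∀ u x, 0 ≤ p u x) ∧ ∑ u, ∑ x, p u x = 1

/-- The classical-quantum state `∑ u, ∑ x, p(u, x) |u⟩⟨u| ⊗ ρˣ` obtained from a pair of states
`(ρ⁰, ρ¹)` used to encode the second component of the joint distribution `p`. -/
noncomputable def cqState {U n : Type*} [Fintype U] [DecidableEq U]
    (p : U → Fin 2 → ℝ) (ρ : Fin 2 → Matrix n n ℂ) : Matrix (U × n) (U × n) ℂ :=
  ∑ u, ∑ x, (p u x : ℂ) • (Matrix.single u u (1 : ℂ) ⊗ₖ ρ x)

/-- The conditional min-entropy `H_min(A|B)` (in bits) of a bipartite state `ρ` on `ℂᴬ ⊗ ℂᴮ`: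
the supremum of the `h : ℝ` such that `ρ ≤ 2⁻ʰ • (1 ⊗ τ)` for some density matrix `τ` on `ℂᴮ`. -/
noncomputable def condMinEntropy {A B : Type*} [Fintype A] [DecidableEq A] [Fintype B]
    (ρ : Matrix (A × B) (A × B) ℂ) : ℝ :=
  sSup {h : ℝ | ∃ τ : Matrix B B ℂ, IsDensityMatrix τ ∧
    ((((2 : ℝ) ^ (-h) : ℝ) : ℂ) • ((1 : Matrix A A ℂ) ⊗ₖ τ) - ρ).PosSemidef}

/-- The information ordering: the pair `ρ` is more informative than the pair `σ` if for every
finite set `U` and every joint distribution `p` on `U × {0, 1}` one has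
`H_min(U|Q)_ρ ≤ H_min(U|Q')_σ` for the corresponding classical-quantum states. -/
def MoreInformative {n m : Type*} [Fintype n] [Fintype m]
    (ρ : Fin 2 → Matrix n n ℂ) (σ : Fin 2 → Matrix m m ℂ) : Prop :=
  ∀ (U : Type) [Fintype U] [DecidableEq U] (p : U → Fin 2 → ℝ), IsJointDistribution p →
    condMinEntropy (cqState p ρ) ≤ condMinEntropy (cqState p σ)

/-- The thermal ordering: `ρ` is less thermal than `σ`, where `ω` and `ω'` are the Gibbs states
of the systems of `ρ` and of `σ` (for a single system, `ω = ω'`). -/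
def LessThermal {n m : Type*} [Fintype n] [Fintype m]
    (ω : Matrix n n ℂ) (ω' : Matrix m m ℂ) (ρ : Matrix n n ℂ) (σ : Matrix m m ℂ) : Prop :=
  MoreInformative ![ρ, ω] ![σ, ω']

/-- A Gibbs-preserving transition from `ρ` to `σ`: a quantum channel that maps `ρ` to `σ` and
the Gibbs state `ω` of the input system to the Gibbs state `ω'` of the output system. -/
def ExistsGibbsPreservingTransition {n m : Type*} [Fintype n] [DecidableEq n]
    [Fintype m] [DecidableEq m]
    (ω : Matrix n n ℂ) (ω' : Matrix m m ℂ) (ρ : Matrix n n ℂ) (σ : Matrix m m ℂ) : Prop :=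
  ∃ Φ : Matrix n n ℂ →CP Matrix m m ℂ, IsTracePreserving Φ ∧ Φ ρ = σ ∧ Φ ω = ω'

/-!
The bridge between the entropic ordering and channels is the guessing game: for a pair of states
`ρ` and a joint distribution `p`, the number `2 ^ (-H_min(U|Q))` is the largest probability with
which a measurement of `Q` guesses `U`.

A channel maps every feasible `τ` in the definition of the conditional min-entropy to a feasible
one, so channels can only increase it (`moreInformative_of_completelyPositiveMap`).

For the converse, half of the guessing game is weak duality
(`successProb_le_of_mem_minEntropySet`). The other half, strong duality
(`IsJointDistribution.exists_successProb_eq`), comes from the optimality conditions for a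
measurement `M`, which exists by compactness: if `B u` are the unnormalized conditional states,
the Hermitian part of `∑ u, M u * B u` dominates every `B u` (`IsPOVM.posSemidef_of_isMaxOn`). This
is seen by perturbing `M` to first order in the direction of a rank one operator. Hence a more
informative pair achieves, in each guessing game, at least the success probability that any given
measurement achieves with the other pair.

The outcome statistics `(u, x) ↦ tr (M u * ρ x)` of all measurements form a compact convex set, and
a separating functional becomes, after adding a constant and rescaling, a joint distribution `p`.
So every statistics obtained from the less informative pair is also obtained from the more
informative one (`MoreInformative.exists_isPOVM_outcomeProb_eq`). As `σ` and `ω'` commute,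
they are diagonal in a common orthonormal basis; measuring `M` with the statistics of the
measurement in this basis and preparing the corresponding basis state is the required channel.
-/

/-! ### Conditional states of a classical-quantum state -/

/-- The unnormalized conditional state `∑ x, p(u, x) ρˣ` of the quantum system when the classical
register of `cqState p ρ` holds `u`. -/
noncomputable def condState {U n : Type*}
    (p : U → Fin 2 → ℝ) (ρ : Fin 2 → Matrix n n ℂ) (u : U) : Matrix n n ℂ :=
  ∑ x, (p u x : ℂ) • ρ x

section
variable {ι U n : Type*} [Fintype ι] [Fintype U]

theorem smul_one_kronecker_sub_cqState [DecidableEq U] (p : U → Fin 2 → ℝ)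
    (ρ : Fin 2 → Matrix n n ℂ) (c : ℂ) (τ : Matrix n n ℂ) :
    c • ((1 : Matrix U U ℂ) ⊗ₖ τ) - cqState p ρ =
      ∑ u, Matrix.single u u (1 : ℂ) ⊗ₖ (c • τ - condState p ρ u) := by
  ext ⟨u, i⟩ ⟨v, j⟩
  simp only [cqState, condState, Matrix.sub_apply, Matrix.smul_apply, Matrix.sum_apply,
    Matrix.kronecker_apply, Matrix.single_apply, Matrix.one_apply, smul_eq_mul]
  rcases eq_or_ne u v with rfl | h
  · simp
  · have h' (w : U) : ¬(w = u ∧ w = v) := fun hw => h (hw.1.symm.trans hw.2)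
    simp [h, h']

variable [Fintype n]

/-- Feasibility in the definition of the conditional min-entropy of a classical-quantum state is a
condition on each of its diagonal blocks. -/
theorem posSemidef_smul_one_kronecker_sub_cqState_iff [DecidableEq U] (p : U → Fin 2 → ℝ)
    (ρ : Fin 2 → Matrix n n ℂ) (c : ℂ) (τ : Matrix n n ℂ) :
    (c • ((1 : Matrix U U ℂ) ⊗ₖ τ) - cqState p ρ).PosSemidef ↔
      ∀ u, (c • τ - condState p ρ u).PosSemidef := by
  classical
  rw [smul_one_kronecker_sub_cqState]
  constructor
  · intro h u
    convert h.submatrix (fun i => (u, i)) using 1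
    ext i j
    simp [Matrix.sum_apply, Matrix.single_apply]
  · intro h
    refine Matrix.posSemidef_sum _ fun u _ => Matrix.PosSemidef.kronecker ?_ (h u)
    rw [← Matrix.diagonal_single]
    exact Matrix.PosSemidef.diagonal (Pi.single_nonneg.2 zero_le_one)

/-! ### Measurements -/

/-- `M` is a measurement (positive operator-valued measure) with outcomes in `ι`. -/
def IsPOVM {ι n : Type*} [Fintype ι] [Fintype n] [DecidableEq n] (M : ι → Matrix n n ℂ) : Prop :=
  (∀ i, (M i).PosSemidef) ∧ ∑ i, M i = 1

theorem Matrix.PosSemidef.trace_mul_nonneg {A B : Matrix n n ℂ}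
    (hA : A.PosSemidef) (hB : B.PosSemidef) : 0 ≤ (A * B).trace := by
  classical
  obtain ⟨C, rfl⟩ := CStarAlgebra.nonneg_iff_eq_star_mul_self.1 hA.nonneg
  rw [mul_assoc, Matrix.trace_mul_comm, Matrix.star_eq_conjTranspose]
  exact (hB.mul_mul_conjTranspose_same C).trace_nonneg

theorem Matrix.PosSemidef.ofReal_re_trace_mul {A B : Matrix n n ℂ}
    (hA : A.PosSemidef) (hB : B.PosSemidef) : (((A * B).trace.re : ℝ) : ℂ) = (A * B).trace :=
  (Complex.eq_re_of_ofReal_le (r := 0) (by simpa using hA.trace_mul_nonneg hB)).symm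

variable [DecidableEq n]

theorem isCompact_setOf_isPOVM : IsCompact {M : ι → Matrix n n ℂ | IsPOVM M} := by
  have hc : IsClosed {M : ι → Matrix n n ℂ | IsPOVM M} := by
    simp only [IsPOVM, Set.ofPred_and, Set.ofPred_forall, ← Matrix.nonneg_iff_posSemidef]
    exact (isClosed_iInter fun i => isClosed_Ici.preimage (continuous_apply i)).inter
      (isClosed_eq (by fun_prop) continuous_const)
  refine (isCompact_univ_pi fun _ => isCompact_closedBall (0 : Matrix n n ℂ) 1).of_isClosed_subset
    hc ?_
  intro M hM i _
  rw [mem_closedBall_zero_iff]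
  refine (CStarAlgebra.norm_le_one_iff_of_nonneg _ (hM.1 i).nonneg).2 ?_
  rw [← hM.2]
  exact Finset.single_le_sum (fun j _ => (hM.1 j).nonneg) (Finset.mem_univ i)

theorem convex_setOf_isPOVM : Convex ℝ {M : ι → Matrix n n ℂ | IsPOVM M} := by
  intro M hM N hN a b ha hb hab
  refine ⟨fun i => ((hM.1 i).smul ha).add ((hN.1 i).smul hb), ?_⟩
  simp only [Pi.add_apply, Pi.smul_apply, Finset.sum_add_distrib, ← Finset.smul_sum, hM.2, hN.2,
    ← add_smul, hab, one_smul]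

theorem exists_isPOVM [Nonempty ι] : ∃ M : ι → Matrix n n ℂ, IsPOVM M := by
  classical
  obtain ⟨i₀⟩ := ‹Nonempty ι›
  refine ⟨Pi.single i₀ 1, fun i => ?_, by simp⟩
  obtain rfl | h := eq_or_ne i i₀
  · simpa using Matrix.PosSemidef.one
  · simpa [h] using Matrix.PosSemidef.zero

end

section

variable {ι n m : Type*} [Fintype ι] [Fintype n]

/-! ### Measure-and-prepare channels -/

/-- The measure-and-prepare map `X ↦ ∑ i, tr (M i * X) • P i`: measure `M` and prepare `P i` on
outcome `i`. -/
def measurePrepare (M : ι → Matrix n n ℂ) (P : ι → Matrix m m ℂ) :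
    Matrix n n ℂ →ₗ[ℂ] Matrix m m ℂ :=
  ∑ i, (Matrix.traceLinearMap n ℂ ℂ ∘ₗ LinearMap.mulLeft ℂ (M i)).smulRight (P i)

theorem measurePrepare_apply (M : ι → Matrix n n ℂ) (P : ι → Matrix m m ℂ) (X : Matrix n n ℂ) :
    measurePrepare M P X = ∑ i, (M i * X).trace • P i := by
  simp [measurePrepare]

theorem trace_star_mul_self_mul_star_mul (T X Y : Matrix n n ℂ) :
    (star T * T * (star X * Y)).trace =
      ∑ r, ∑ s, star ((X * star T) r s) * (Y * star T) r s := by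
  have : (star T * T * (star X * Y)).trace = (star (X * star T) * (Y * star T)).trace := by
    rw [star_mul, star_star, mul_assoc, Matrix.trace_mul_comm]
    simp only [mul_assoc]
  rw [this, Finset.sum_comm]
  simp only [Matrix.trace, Matrix.diag_apply, Matrix.mul_apply, Matrix.star_apply]

theorem CStarMatrix.sum_apply {k l A : Type*} [AddCommMonoid A] (f : ι → CStarMatrix k l A)
    (a : k) (b : l) : (∑ i, f i) a b = ∑ i, f i a b :=
  Matrix.sum_apply a b Finset.univ f

variable [Fintype m] [DecidableEq n] [DecidableEq m]

/-- The map `measurePrepare M P` for positive semidefinite `M i` and `P i`, as a completely positive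
map. -/
noncomputable def measurePrepareCP (M : ι → Matrix n n ℂ) (P : ι → Matrix m m ℂ)
    (hM : ∀ i, (M i).PosSemidef) (hP : ∀ i, (P i).PosSemidef) :
    Matrix n n ℂ →CP Matrix m m ℂ where
  toLinearMap := measurePrepare M P
  map_cstarMatrix_nonneg' k N hN := by
    choose T hT using fun i => CStarAlgebra.nonneg_iff_eq_star_mul_self.1 (hM i).nonneg
    choose S hS using fun i => CStarAlgebra.nonneg_iff_eq_star_mul_self.1 (hP i).nonneg
    -- A positive element is a sum of elements `star L * L`.
    induction StarOrderedRing.nonneg_iff.1 hN using AddSubmonoid.closure_induction with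
    | zero => exact le_of_eq (by ext a b : 2; simp)
    | add A B hA hB hA' hB' =>
      have hA0 := StarOrderedRing.nonneg_iff.2 hA
      have hB0 := StarOrderedRing.nonneg_iff.2 hB
      refine (add_nonneg (hA' hA0) (hB' hB0)).trans_eq (by ext a b : 2; simp)
    | mem x hx =>
    obtain ⟨L, rfl⟩ := hx
    -- If `M i = (T i)ᴴ * T i` and `v c a` is the `(r, s)` entry of `L c a * (T i)ᴴ`, then
    -- `tr (M i * (star L * L) a b)` is the sum of `star (v c a) * v c b` over `c`, `r` and `s`.
    let D (i : ι) (r s : n) : CStarMatrix (Fin k) (Fin k) (Matrix m m ℂ) :=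
      CStarMatrix.ofMatrix fun a b => (L a b * star (T i)) r s • S i
    have key : (star L * L).map (measurePrepare M P) =
        ∑ i, ∑ r, ∑ s, star (D i r s) * D i r s := by
      refine CStarMatrix.ext fun a b => ?_
      have hD (i r s) (c : Fin k) : star (D i r s c a) * D i r s c b =
          (star ((L c a * star (T i)) r s) * (L c b * star (T i)) r s) • P i := by
        rw [hS i, ← smul_mul_smul_comm, ← star_smul]
        rfl
      simp only [CStarMatrix.map_apply, CStarMatrix.mul_apply, map_sum, CStarMatrix.star_apply,
        measurePrepare_apply, CStarMatrix.sum_apply, hD, ← Finset.sum_smul]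
      rw [Finset.sum_comm]
      refine Finset.sum_congr rfl fun i _ => ?_
      rw [← Finset.sum_smul, hT i]
      simp only [trace_star_mul_self_mul_star_mul]
      rw [Finset.sum_comm]
      exact congrArg (· • P i) (Finset.sum_congr rfl fun r _ => Finset.sum_comm)
    rw [key]
    exact Finset.sum_nonneg fun i _ => Finset.sum_nonneg fun r _ => Finset.sum_nonneg fun s _ =>
      star_mul_self_nonneg _

/-! ### Simultaneous diagonalization -/

/-- Two commuting Hermitian matrices are diagonal in a common orthonormal basis; `P u` are the
rank one projections onto its vectors. -/
theorem exists_isPOVM_of_commute {A B : Matrix m m ℂ} (hA : A.IsHermitian) (hB : B.IsHermitian)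
    (hAB : Commute A B) :
    ∃ P : Fin (Fintype.card m) → Matrix m m ℂ, IsPOVM P ∧ (∀ u, (P u).trace = 1) ∧
      ∑ u, (P u * A).trace • P u = A ∧ ∑ u, (P u * B).trace • P u = B := by
  classical
  have hA' := Matrix.isSymmetric_toEuclideanLin_iff.2 hA
  have hB' := Matrix.isSymmetric_toEuclideanLin_iff.2 hB
  have hc : Commute (Matrix.toEuclideanLin A) (Matrix.toEuclideanLin B) := by
    rw [commute_iff_eq, Module.End.mul_eq_comp, Module.End.mul_eq_comp, ← Matrix.toLpLin_mul_same,
      ← Matrix.toLpLin_mul_same, hAB.eq]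
  have hV := LinearMap.IsSymmetric.directSum_isInternal_of_commute hA' hB' hc
  have hV' := LinearMap.IsSymmetric.orthogonalFamily_eigenspace_inf_eigenspace hA' hB'
  -- Only finitely many joint eigenspaces are nonzero, and these index the decomposition below.
  let := hV.submodule_iSupIndep.fintypeNeBotOfFiniteDimensional
  have hW := DirectSum.isInternal_ne_bot_iff.2 hV
  have hW' := hV'.comp (Subtype.val_injective
    (p := fun i => Module.End.eigenspace (Matrix.toEuclideanLin A) i.2 ⊓
      Module.End.eigenspace (Matrix.toEuclideanLin B) i.1 ≠ ⊥))
  have hrank := finrank_euclideanSpace (𝕜 := ℂ) (ι := m)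
  let b := hW.subordinateOrthonormalBasis hrank hW'
  have hb u := hW.subordinateOrthonormalBasis_subordinate hrank u hW'
  have hbA (u) : ∃ s : ℂ, A *ᵥ (b u).ofLp = s • (b u).ofLp :=
    ⟨_, congrArg WithLp.ofLp (Module.End.mem_eigenspace_iff.1 (hb u).1)⟩
  have hbB (u) : ∃ s : ℂ, B *ᵥ (b u).ofLp = s • (b u).ofLp :=
    ⟨_, congrArg WithLp.ofLp (Module.End.mem_eigenspace_iff.1 (hb u).2)⟩
  have hone : ∑ u, Matrix.vecMulVec (b u).ofLp (star (b u).ofLp) = 1 := by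
    ext i j
    have := congrArg (fun v => v.ofLp i) (b.sum_repr' (EuclideanSpace.single j (1 : ℂ)))
    simpa [Matrix.sum_apply, Matrix.vecMulVec_apply, EuclideanSpace.inner_single_right,
      Matrix.one_apply, mul_comm, Pi.single_apply] using this
  have htr u : (b u).ofLp ⬝ᵥ star (b u).ofLp = 1 := by
    rw [← EuclideanSpace.inner_eq_star_dotProduct]
    exact inner_self_eq_one_of_norm_eq_one (b.norm_eq_one u)
  have hdiag {C : Matrix m m ℂ} (hC : ∀ u, ∃ s : ℂ, C *ᵥ (b u).ofLp = s • (b u).ofLp) :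
      ∑ u, (Matrix.vecMulVec (b u).ofLp (star (b u).ofLp) * C).trace •
        Matrix.vecMulVec (b u).ofLp (star (b u).ofLp) = C := by
    conv_rhs => rw [← mul_one C, ← hone, Finset.mul_sum]
    refine Finset.sum_congr rfl fun u _ => ?_
    obtain ⟨s, hs⟩ := hC u
    rw [Matrix.trace_mul_comm, Matrix.mul_vecMulVec, hs, Matrix.smul_vecMulVec, Matrix.trace_smul,
      Matrix.trace_vecMulVec, htr, smul_eq_mul, mul_one]
  exact ⟨fun u => Matrix.vecMulVec (b u).ofLp (star (b u).ofLp),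
    ⟨fun u => Matrix.posSemidef_vecMulVec_self_star _, hone⟩,
    fun u => by rw [Matrix.trace_vecMulVec, htr], hdiag hbA, hdiag hbB⟩

end

section

variable {ι n : Type*} [Fintype ι] [Fintype n] [DecidableEq n]

/-! ### Optimality conditions for measurements -/

theorem nonpos_of_forall_mul_le_mul_sq {a b δ : ℝ} (hδ : 0 < δ)
    (h : ∀ ε, 0 < ε → ε < δ → ε * a ≤ ε ^ 2 * b) : a ≤ 0 := by
  by_contra! ha
  have hb : 0 < |b| + 1 := by positivity
  set ε := min (δ / 2) (a / (2 * (|b| + 1)))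
  have hε : 0 < ε := by positivity
  have h1 := h ε hε (lt_of_le_of_lt (min_le_left _ _) (by linarith))
  rw [pow_two, mul_assoc] at h1
  have h2 := le_of_mul_le_mul_left h1 hε
  have h3 : ε * b ≤ a / (2 * (|b| + 1)) * (|b| + 1) := by
    refine (mul_le_mul_of_nonneg_left ((le_abs_self b).trans (by linarith)) hε.le).trans
      (mul_le_mul_of_nonneg_right (min_le_right _ _) hb.le)
  have h4 : a / (2 * (|b| + 1)) * (|b| + 1) = a / 2 := by field_simp
  linarith

/-- A perturbation of a measurement: conjugate every `M v` by `1 - ε |x⟩⟨x|` and assign to the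
outcome `u` what is then missing from the identity. -/
theorem IsPOVM.perturb [DecidableEq ι] {M : ι → Matrix n n ℂ} (hM : IsPOVM M) (u : ι)
    (x : n → ℂ) {ε : ℝ} (hε : 0 ≤ ε) (hε' : ε * (star x ⬝ᵥ x).re ≤ 1) :
    IsPOVM fun v => (1 - (ε : ℂ) • Matrix.vecMulVec x (star x)) * M v *
        (1 - (ε : ℂ) • Matrix.vecMulVec x (star x)) +
      if v = u then (1 - (1 - (ε : ℂ) • Matrix.vecMulVec x (star x)) ^ 2) else 0 := by
  set P := Matrix.vecMulVec x (star x) with hP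
  have hPsd : P.PosSemidef := Matrix.posSemidef_vecMulVec_self_star x
  have hC : (1 - (ε : ℂ) • P)ᴴ = 1 - (ε : ℂ) • P := by
    rw [Matrix.conjTranspose_sub, Matrix.conjTranspose_one, Matrix.conjTranspose_smul, hPsd.1.eq]
    simp
  have hr : star x ⬝ᵥ x = ((star x ⬝ᵥ x).re : ℂ) :=
    Complex.eq_re_of_ofReal_le (r := 0) (by simp [dotProduct_star_self_nonneg])
  have hPP : P * P = ((star x ⬝ᵥ x).re : ℂ) • P := by
    rw [hP, Matrix.vecMulVec_mul_vecMulVec, ← hr]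
    simp
  have hres : 1 - (1 - (ε : ℂ) • P) ^ 2 = ((ε * (2 - ε * (star x ⬝ᵥ x).re) : ℝ) : ℂ) • P := by
    rw [pow_two, sub_mul, mul_sub, mul_sub, smul_mul_smul_comm, hPP, smul_smul]
    push_cast
    simp only [one_mul, mul_one]
    module
  refine ⟨fun v => Matrix.PosSemidef.add ?_ ?_, ?_⟩
  · have := (hM.1 v).conjTranspose_mul_mul_same (1 - (ε : ℂ) • P)
    rwa [hC] at this
  · split_ifs
    · rw [hres]
      refine hPsd.smul ?_
      exact_mod_cast mul_nonneg hε (by linarith)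
    · exact Matrix.PosSemidef.zero
  · rw [Finset.sum_add_distrib, ← Finset.sum_mul, ← Finset.mul_sum, hM.2]
    simp [pow_two]

/-- The optimality condition for the discrimination of the operators `B v`: if `M` maximizes
`∑ v, tr (M v * B v)`, then the Hermitian part of `∑ v, M v * B v` dominates every `B u`. This
says that the first variation along `IsPOVM.perturb` is not positive. -/
theorem IsPOVM.posSemidef_of_isMaxOn [DecidableEq ι] {M B : ι → Matrix n n ℂ} (hM : IsPOVM M)
    (hB : ∀ v, (B v).IsHermitian)
    (hmax : ∀ N : ι → Matrix n n ℂ, IsPOVM N →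
      ∑ v, (N v * B v).trace.re ≤ ∑ v, (M v * B v).trace.re) (u : ι) :
    ((1 / 2 : ℂ) • ∑ v, (M v * B v + B v * M v) - B u).PosSemidef := by
  set S := ∑ v, (M v * B v + B v * M v) with hS
  have hH : ((1 / 2 : ℂ) • S - B u).IsHermitian := by
    refine Matrix.IsHermitian.sub ?_ (hB u)
    rw [Matrix.IsHermitian, Matrix.conjTranspose_smul, hS, Matrix.conjTranspose_sum]
    congr 1
    · simp
    · refine Finset.sum_congr rfl fun v _ => ?_
      rw [Matrix.conjTranspose_add, Matrix.conjTranspose_mul, Matrix.conjTranspose_mul, (hB v).eq,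
        (hM.1 v).1.eq, add_comm]
  refine Matrix.PosSemidef.of_dotProduct_mulVec_nonneg hH fun x => ?_
  set P := Matrix.vecMulVec x (star x) with hP
  have hPtr (A : Matrix n n ℂ) : (P * A).trace = star x ⬝ᵥ A *ᵥ x := by
    rw [Matrix.trace_mul_comm, hP, Matrix.mul_vecMulVec, Matrix.trace_vecMulVec, dotProduct_comm]
  have hexp (ε : ℝ) (v : ι) : (((1 - (ε : ℂ) • P) * M v * (1 - (ε : ℂ) • P)) * B v).trace =
      (M v * B v).trace - ε * (P * (M v * B v + B v * M v)).trace
        + (ε ^ 2 : ℝ) * (P * M v * P * B v).trace := by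
    have h1 : (P * (B v * M v)).trace = (M v * P * B v).trace := by
      rw [← mul_assoc, Matrix.trace_mul_comm, mul_assoc]
    simp only [sub_mul, mul_sub, one_mul, mul_one, smul_mul_assoc, mul_smul_comm,
      Matrix.trace_sub, Matrix.trace_smul, mul_add, Matrix.trace_add, h1, smul_eq_mul]
    push_cast
    simp only [mul_assoc]
    ring
  have hexp' (ε : ℝ) : ((1 - (1 - (ε : ℂ) • P) ^ 2) * B u).trace =
      2 * ε * (P * B u).trace - (ε ^ 2 : ℝ) * (P * P * B u).trace := by
    simp only [pow_two, sub_mul, mul_sub, one_mul, mul_one, smul_mul_assoc, mul_smul_comm,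
      Matrix.trace_sub, Matrix.trace_smul, smul_eq_mul]
    push_cast
    simp only [mul_assoc]
    ring
  have hle : 2 * (P * B u).trace.re - (P * S).trace.re ≤ 0 := by
    have hr : 0 ≤ (star x ⬝ᵥ x).re :=
      (Complex.le_def.1 (dotProduct_star_self_nonneg x)).1
    refine nonpos_of_forall_mul_le_mul_sq
      (b := (P * P * B u).trace.re - ∑ v, (P * M v * P * B v).trace.re)
      (δ := 1 / ((star x ⬝ᵥ x).re + 1)) (by positivity) fun ε hε hεδ => ?_
    rw [lt_div_iff₀ (by positivity)] at hεδ
    have h := hmax _ (hM.perturb u x hε.le (by linarith))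
    simp only [add_mul, Matrix.trace_add, Complex.add_re, Finset.sum_add_distrib, ite_mul,
      zero_mul, apply_ite Matrix.trace, Matrix.trace_zero, apply_ite Complex.re, Complex.zero_re,
      Finset.sum_ite_eq', Finset.mem_univ, if_true, ← hP, hexp, hexp', Complex.sub_re,
      Complex.re_ofReal_mul, Finset.sum_sub_distrib, ← Finset.mul_sum] at h
    have hS' : (P * S).trace.re = ∑ v, (P * (M v * B v + B v * M v)).trace.re := by
      rw [hS, Finset.mul_sum, Matrix.trace_sum, Complex.re_sum]
    have h2 : (2 * (ε : ℂ) * (P * B u).trace).re = 2 * ε * (P * B u).trace.re := by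
      rw [mul_assoc, ← Complex.ofReal_ofNat, Complex.re_ofReal_mul, Complex.re_ofReal_mul,
        mul_assoc]
    rw [hS']
    linarith
  rw [Complex.le_def]
  refine ⟨?_, (hH.im_star_dotProduct_mulVec_self x).symm⟩
  rw [← hPtr, mul_sub, Matrix.trace_sub, mul_smul_comm, Matrix.trace_smul, smul_eq_mul,
    Complex.sub_re, show (1 / 2 : ℂ) = ((1 / 2 : ℝ) : ℂ) by norm_num, Complex.re_ofReal_mul,
    Complex.zero_re]
  linarith
end

section

variable {U n m : Type*} [Fintype U] [Fintype n] [Fintype m]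
  {p : U → Fin 2 → ℝ} {ρ : Fin 2 → Matrix n n ℂ} {h : ℝ}

/-! ### Guessing probability and min-entropy -/

/-- The set of the `h : ℝ` over which the supremum in the conditional min-entropy of `cqState p ρ`
is taken, expressed through the conditional states. -/
noncomputable def minEntropySet (p : U → Fin 2 → ℝ) (ρ : Fin 2 → Matrix n n ℂ) : Set ℝ :=
  {h | ∃ τ : Matrix n n ℂ, IsDensityMatrix τ ∧
    ∀ u, ((((2 : ℝ) ^ (-h) : ℝ) : ℂ) • τ - condState p ρ u).PosSemidef}

theorem condMinEntropy_cqState [DecidableEq U] (p : U → Fin 2 → ℝ) (ρ : Fin 2 → Matrix n n ℂ) :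
    condMinEntropy (cqState p ρ) = sSup (minEntropySet p ρ) := by
  simp only [condMinEntropy, minEntropySet, posSemidef_smul_one_kronecker_sub_cqState_iff]

/-- The probability that the outcome of the measurement `M` on the quantum part of `cqState p ρ`
equals the value of the classical register. -/
noncomputable def successProb (p : U → Fin 2 → ℝ) (ρ : Fin 2 → Matrix n n ℂ)
    (M : U → Matrix n n ℂ) : ℝ :=
  ∑ u, (M u * condState p ρ u).trace.re

theorem successProb_eq_sum (p : U → Fin 2 → ℝ) (ρ : Fin 2 → Matrix n n ℂ)
    (M : U → Matrix n n ℂ) :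
    successProb p ρ M = ∑ u, ∑ x, p u x * (M u * ρ x).trace.re := by
  simp only [successProb, condState, Finset.mul_sum, mul_smul_comm, Matrix.trace_sum,
    Matrix.trace_smul, Complex.re_sum, smul_eq_mul, Complex.re_ofReal_mul]

theorem IsJointDistribution.posSemidef_condState (hp : IsJointDistribution p)
    (hρ : ∀ x, IsDensityMatrix (ρ x)) (u : U) : (condState p ρ u).PosSemidef :=
  Matrix.posSemidef_sum _ fun x _ => (hρ x).1.smul (by exact_mod_cast hp.1 u x)

theorem IsJointDistribution.sum_trace_condState (hp : IsJointDistribution p)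
    (hρ : ∀ x, IsDensityMatrix (ρ x)) : ∑ u, (condState p ρ u).trace = 1 := by
  simp only [condState, Matrix.trace_sum, Matrix.trace_smul, (hρ _).2, smul_eq_mul, mul_one]
  exact_mod_cast hp.2

theorem IsJointDistribution.le_one (hp : IsJointDistribution p) (u : U) (x : Fin 2) :
    p u x ≤ 1 := by
  rw [← hp.2]
  exact (Finset.single_le_sum (f := p u) (fun y _ => hp.1 u y) (Finset.mem_univ x)).trans
    (Finset.single_le_sum (f := fun v => ∑ y, p v y)
      (fun v _ => Finset.sum_nonneg fun y _ => hp.1 v y) (Finset.mem_univ u))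

theorem IsJointDistribution.nonempty (hp : IsJointDistribution p) : Nonempty U := by
  by_contra hU
  rw [not_nonempty_iff] at hU
  simpa using hp.2

theorem IsJointDistribution.nonempty_minEntropySet (hp : IsJointDistribution p)
    (hρ : ∀ x, IsDensityMatrix (ρ x)) : (minEntropySet p ρ).Nonempty := by
  -- `2 ^ (-(-1))` times the average of the two states is `ρ⁰ + ρ¹`, which dominates every
  -- conditional state because `p u x ≤ 1`.
  refine ⟨-1, (1 / 2 : ℂ) • ∑ x, ρ x, ⟨?_, ?_⟩, fun u => ?_⟩
  · exact (Matrix.posSemidef_sum _ fun x _ => (hρ x).1).smul (by norm_num [Complex.le_def])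
  · simp [(hρ _).2]
    norm_num
  · have : (((2 : ℝ) ^ (-(-1 : ℝ)) : ℝ) : ℂ) • (1 / 2 : ℂ) • ∑ x, ρ x - condState p ρ u =
        ∑ x, ((1 - p u x : ℝ) : ℂ) • ρ x := by
      simp [condState, smul_smul, sub_smul, Finset.sum_sub_distrib]
    rw [this]
    exact Matrix.posSemidef_sum _ fun x _ =>
      (hρ x).1.smul (by exact_mod_cast sub_nonneg.2 (hp.le_one u x))

/-- Comparing traces shows that every feasible `h` is at most `log₂ |U|`. -/
theorem IsJointDistribution.bddAbove_minEntropySet (hp : IsJointDistribution p)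
    (hρ : ∀ x, IsDensityMatrix (ρ x)) : BddAbove (minEntropySet p ρ) := by
  have hU : (0 : ℝ) < Fintype.card U := by
    have := hp.nonempty
    exact_mod_cast Fintype.card_pos
  refine ⟨Real.logb 2 (Fintype.card U), ?_⟩
  rintro h ⟨τ, hτ, hle⟩
  have h1 := (Matrix.posSemidef_sum Finset.univ fun u _ => hle u).trace_nonneg
  rw [Finset.sum_sub_distrib, Matrix.trace_sub, Matrix.trace_sum _ (condState p ρ),
    hp.sum_trace_condState hρ, Finset.sum_const, Matrix.trace_smul, Matrix.trace_smul, hτ.2,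
    Finset.card_univ, smul_eq_mul, mul_one, nsmul_eq_mul, sub_nonneg] at h1
  have h2 : 1 ≤ (Fintype.card U : ℝ) * 2 ^ (-h) := by exact_mod_cast h1
  rw [Real.rpow_neg two_pos.le, ← div_eq_mul_inv, one_le_div (by positivity)] at h2
  rwa [Real.le_logb_iff_rpow_le one_lt_two hU]

variable [DecidableEq n] [DecidableEq m]

/-- Weak duality: no measurement guesses with probability above `2 ^ (-h)` for feasible `h`. -/
theorem successProb_le_of_mem_minEntropySet {M : U → Matrix n n ℂ} (hM : IsPOVM M)
    (hh : h ∈ minEntropySet p ρ) : successProb p ρ M ≤ 2 ^ (-h) := by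
  obtain ⟨τ, hτ, hle⟩ := hh
  have h1 : ∑ u, (M u * ((((2 : ℝ) ^ (-h) : ℝ) : ℂ) • τ)).trace.re = 2 ^ (-h) := by
    rw [← Complex.re_sum, ← Matrix.trace_sum, ← Finset.sum_mul, hM.2, one_mul, Matrix.trace_smul,
      hτ.2, smul_eq_mul, mul_one, Complex.ofReal_re]
  rw [← h1]
  refine Finset.sum_le_sum fun u _ => ?_
  have h2 := (Complex.le_def.1 ((hM.1 u).trace_mul_nonneg (hle u))).1
  rw [mul_sub, Matrix.trace_sub, Complex.sub_re, Complex.zero_re] at h2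
  linarith

/-- Strong duality: some measurement guesses with probability exactly `2 ^ (-h)` for some feasible
`h`, which then is the conditional min-entropy. -/
theorem IsJointDistribution.exists_successProb_eq (hp : IsJointDistribution p)
    (hρ : ∀ x, IsDensityMatrix (ρ x)) :
    ∃ M : U → Matrix n n ℂ, IsPOVM M ∧ ∃ h ∈ minEntropySet p ρ, successProb p ρ M = 2 ^ (-h) := by
  classical
  have := hp.nonempty
  have hcont : Continuous fun M : U → Matrix n n ℂ => successProb p ρ M := by
    unfold successProb
    fun_prop
  obtain ⟨M, hM, hmax⟩ := isCompact_setOf_isPOVM.exists_isMaxOn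
    (exists_isPOVM (ι := U) (n := n)) hcont.continuousOn
  have hK := IsPOVM.posSemidef_of_isMaxOn hM (fun u => (hp.posSemidef_condState hρ u).1)
    (fun N hN => hmax hN)
  set K := (1 / 2 : ℂ) • ∑ v, (M v * condState p ρ v + condState p ρ v * M v) with hKdef
  have htr : K.trace = (successProb p ρ M : ℂ) := by
    rw [hKdef, Matrix.trace_smul, Matrix.trace_sum, successProb, Complex.ofReal_sum, smul_eq_mul,
      Finset.mul_sum]
    refine Finset.sum_congr rfl fun v _ => ?_
    rw [(hM.1 v).ofReal_re_trace_mul (hp.posSemidef_condState hρ v), Matrix.trace_add,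
      Matrix.trace_mul_comm (condState p ρ v)]
    ring
  -- The trace of `K` is at least that of every conditional state, and these sum to `1`.
  have hpos : 0 < successProb p ρ M := by
    have h1 := (Matrix.posSemidef_sum Finset.univ fun u _ => hK u).trace_nonneg
    rw [Finset.sum_sub_distrib, Matrix.trace_sub, Matrix.trace_sum _ (condState p ρ),
      hp.sum_trace_condState hρ, Finset.sum_const, Matrix.trace_smul, htr,
      Finset.card_univ, nsmul_eq_mul, sub_nonneg] at h1
    have h2 : 1 ≤ (Fintype.card U : ℝ) * successProb p ρ M := by exact_mod_cast h1
    exact pos_of_mul_pos_right (one_pos.trans_le h2) (Nat.cast_nonneg _)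
  have hpow : (2 : ℝ) ^ (-(-Real.logb 2 (successProb p ρ M))) = successProb p ρ M := by
    rw [neg_neg, Real.rpow_logb two_pos (by norm_num) hpos]
  refine ⟨M, hM, -Real.logb 2 (successProb p ρ M),
    ⟨((successProb p ρ M)⁻¹ : ℂ) • K, ⟨?_, ?_⟩, fun u => ?_⟩, hpow.symm⟩
  · obtain ⟨u₀⟩ := this
    have hK0 : K.PosSemidef := by
      simpa using (hK u₀).add (hp.posSemidef_condState hρ u₀)
    exact hK0.smul (by exact_mod_cast inv_nonneg.2 hpos.le)
  · rw [Matrix.trace_smul, htr, smul_eq_mul]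
    exact inv_mul_cancel₀ (by exact_mod_cast hpos.ne')
  · rw [hpow, smul_smul, mul_inv_cancel₀ (by exact_mod_cast hpos.ne'), one_smul]
    exact hK u

/-- In every guessing game, the more informative pair allows a success probability at least as high
as any measurement has with the other pair. -/
theorem MoreInformative.exists_successProb_le {U : Type} [Fintype U] {p : U → Fin 2 → ℝ}
    {σ : Fin 2 → Matrix m m ℂ} (hρσ : MoreInformative ρ σ)
    (hρ : ∀ x, IsDensityMatrix (ρ x)) (hσ : ∀ x, IsDensityMatrix (σ x))
    (hp : IsJointDistribution p) {P : U → Matrix m m ℂ} (hP : IsPOVM P) :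
    ∃ M : U → Matrix n n ℂ, IsPOVM M ∧ successProb p σ P ≤ successProb p ρ M := by
  classical
  obtain ⟨M, hM, h, hh, hMh⟩ := hp.exists_successProb_eq hρ
  refine ⟨M, hM, ?_⟩
  by_contra! hlt
  have hpos : 0 < successProb p σ P := lt_trans (hMh ▸ by positivity) hlt
  have h1 : h ≤ sSup (minEntropySet p σ) := by
    refine (le_csSup (hp.bddAbove_minEntropySet hρ) hh).trans ?_
    rw [← condMinEntropy_cqState, ← condMinEntropy_cqState]
    exact hρσ U p hp
  have h2 : sSup (minEntropySet p σ) ≤ -Real.logb 2 (successProb p σ P) := by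
    refine csSup_le (hp.nonempty_minEntropySet hσ) fun k hk => le_neg.1 ?_
    rw [Real.logb_le_iff_le_rpow one_lt_two hpos]
    exact successProb_le_of_mem_minEntropySet hP hk
  have h3 : successProb p σ P ≤ successProb p ρ M := by
    rw [hMh, ← Real.logb_le_iff_le_rpow one_lt_two hpos]
    linarith
  exact hlt.not_ge h3

/-- Data processing: a channel makes a pair of states less informative. -/
theorem moreInformative_of_completelyPositiveMap {σ : Fin 2 → Matrix m m ℂ}
    (hρ : ∀ x, IsDensityMatrix (ρ x)) (hσ : ∀ x, IsDensityMatrix (σ x))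
    (Φ : Matrix n n ℂ →CP Matrix m m ℂ) (hΦ : IsTracePreserving Φ) (hΦρ : ∀ x, Φ (ρ x) = σ x) :
    MoreInformative ρ σ := by
  intro U _ _ p hp
  have hpos {X : Matrix n n ℂ} (hX : X.PosSemidef) : (Φ X).PosSemidef :=
    Matrix.nonneg_iff_posSemidef.1 (map_nonneg Φ hX.nonneg)
  rw [condMinEntropy_cqState, condMinEntropy_cqState]
  refine csSup_le_csSup (hp.bddAbove_minEntropySet hσ) (hp.nonempty_minEntropySet hρ) ?_
  rintro h ⟨τ, hτ, hle⟩
  refine ⟨Φ τ, ⟨hpos hτ.1, (hΦ τ).trans hτ.2⟩, fun u => ?_⟩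
  have hcond : Φ (condState p ρ u) = condState p σ u := by
    simp only [condState, map_sum, map_smul, hΦρ]
  simpa only [map_sub, map_smul, hcond] using hpos (hle u)

/-! ### Simulation of measurement statistics -/

/-- The statistics of a measurement `M` on a pair of states `ρ`: the entry at `u`, `x` is the
probability `tr (M u * ρ x)` of the outcome `u` in the state `ρ x`. The real part makes it a
real-linear map on arbitrary families of matrices. -/
def outcomeProb (ι : Type*) (ρ : Fin 2 → Matrix n n ℂ) :
    (ι → Matrix n n ℂ) →ₗ[ℝ] (ι → Fin 2 → ℝ) where
  toFun M u x := (M u * ρ x).trace.re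
  map_add' M N := by
    ext u x
    simp [add_mul]
  map_smul' c M := by
    ext u x
    simp

theorem IsPOVM.sum_outcomeProb {ι : Type*} [Fintype ι] {M : ι → Matrix n n ℂ} (hM : IsPOVM M)
    (hρ : ∀ x, IsDensityMatrix (ρ x)) : ∑ u, ∑ x, outcomeProb ι ρ M u x = 2 := by
  have h1 (x) : ∑ u, outcomeProb ι ρ M u x = 1 := by
    change ∑ u, (M u * ρ x).trace.re = 1
    rw [← Complex.re_sum, ← Matrix.trace_sum, ← Finset.sum_mul, hM.2, one_mul, (hρ x).2,
      Complex.one_re]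
  rw [Finset.sum_comm]
  simp [h1]

/-- Turning a linear functional with coefficients `a` into a guessing game by `(a + C) / Z` changes
its values on measurement statistics by a fixed affine map, since both states have unit trace. -/
theorem IsPOVM.successProb_add_const_div {M : U → Matrix n n ℂ} (hM : IsPOVM M)
    (hρ : ∀ x, IsDensityMatrix (ρ x)) (a : U → Fin 2 → ℝ) (C Z : ℝ) :
    successProb (fun u x => (a u x + C) / Z) ρ M =
      (∑ u, ∑ x, a u x * outcomeProb U ρ M u x + C * 2) / Z := by
  rw [successProb_eq_sum, ← hM.sum_outcomeProb hρ]
  simp only [Finset.mul_sum, ← Finset.sum_add_distrib, Finset.sum_div]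
  refine Finset.sum_congr rfl fun u _ => Finset.sum_congr rfl fun x _ => ?_
  change (a u x + C) / Z * outcomeProb U ρ M u x = _
  ring

theorem exists_eq_sum_mul {ι κ : Type*} [Fintype ι] [Fintype κ] [DecidableEq ι] [DecidableEq κ]
    (f : (ι → κ → ℝ) →ₗ[ℝ] ℝ) : ∃ a : ι → κ → ℝ, ∀ v, f v = ∑ u, ∑ x, a u x * v u x := by
  refine ⟨fun u x => f (Pi.single u fun y => if x = y then 1 else 0), fun v => ?_⟩
  conv_lhs => rw [← Finset.univ_sum_single v, map_sum]
  refine Finset.sum_congr rfl fun u _ => ?_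
  refine ((f ∘ₗ LinearMap.single ℝ _ u).pi_apply_eq_sum_univ (v u)).trans ?_
  exact Finset.sum_congr rfl fun x _ => mul_comm _ _

/-- All measurement statistics of the less informative pair are also statistics of the more
informative one: a functional separating them would be a guessing game that is won more often with
the less informative pair. -/
theorem MoreInformative.exists_isPOVM_outcomeProb_eq {ι : Type} [Fintype ι] [Nonempty ι]
    {σ : Fin 2 → Matrix m m ℂ} (hρσ : MoreInformative ρ σ)
    (hρ : ∀ x, IsDensityMatrix (ρ x)) (hσ : ∀ x, IsDensityMatrix (σ x))
    {P : ι → Matrix m m ℂ} (hP : IsPOVM P) :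
    ∃ M : ι → Matrix n n ℂ, IsPOVM M ∧ outcomeProb ι ρ M = outcomeProb ι σ P := by
  classical
  by_contra hne
  have hnot : outcomeProb ι σ P ∉ outcomeProb ι ρ '' {M | IsPOVM M} := hne
  have hcont : Continuous (outcomeProb ι ρ) := by
    change Continuous fun (M : ι → Matrix n n ℂ) u x => (M u * ρ x).trace.re
    fun_prop
  obtain ⟨f, c, hf, hc⟩ := geometric_hahn_banach_closed_point
    (convex_setOf_isPOVM.linear_image (outcomeProb ι ρ))
    (isCompact_setOf_isPOVM.image hcont).isClosed hnot
  obtain ⟨a, hfa⟩ := exists_eq_sum_mul f.toLinearMap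
  -- A constant large enough to make all coefficients positive.
  let C : ℝ := 1 + ∑ u, ∑ x, |a u x|
  have hCpos (u x) : 0 < a u x + C := by
    have h1 : |a u x| ≤ ∑ v, ∑ y, |a v y| :=
      (Finset.single_le_sum (f := fun y => |a u y|) (fun y _ => abs_nonneg _)
        (Finset.mem_univ x)).trans
        (Finset.single_le_sum (f := fun v => ∑ y, |a v y|)
          (fun v _ => Finset.sum_nonneg fun y _ => abs_nonneg _) (Finset.mem_univ u))
    have h2 := neg_abs_le (a u x)
    simp only [C]
    linarith
  let Z : ℝ := ∑ u, ∑ x, (a u x + C)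
  have hZ : 0 < Z := Finset.sum_pos (fun u _ => Finset.sum_pos (fun x _ => hCpos u x)
    Finset.univ_nonempty) Finset.univ_nonempty
  have hp : IsJointDistribution fun u x => (a u x + C) / Z :=
    ⟨fun u x => (div_pos (hCpos u x) hZ).le, by
      simp only [← Finset.sum_div]
      exact div_self hZ.ne'⟩
  obtain ⟨M, hM, hle⟩ := hρσ.exists_successProb_le hρ hσ hp hP
  have h1 : f (outcomeProb ι ρ M) < f (outcomeProb ι σ P) := (hf _ ⟨M, hM, rfl⟩).trans hc
  rw [hP.successProb_add_const_div hσ, hM.successProb_add_const_div hρ,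
    div_le_div_iff_of_pos_right hZ, ← hfa, ← hfa] at hle
  change f _ + _ ≤ f _ + _ at hle
  linarith

end

/-! ### Gibbs-preserving transitions -/

theorem proposition2 {n m : Type*} [Fintype n] [DecidableEq n] [Fintype m] [DecidableEq m]
    (ω ρ : Matrix n n ℂ) (ω' σ : Matrix m m ℂ)
    (hω : IsDensityMatrix ω) (hρ : IsDensityMatrix ρ)
    (hω' : IsDensityMatrix ω') (hσ : IsDensityMatrix σ)
    (hcomm : Commute σ ω') :
    ExistsGibbsPreservingTransition ω ω' ρ σ ↔ LessThermal ω ω' ρ σ := by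
  have hρω : ∀ x, IsDensityMatrix (![ρ, ω] x) := Fin.forall_fin_two.2 ⟨hρ, hω⟩
  have hσω : ∀ x, IsDensityMatrix (![σ, ω'] x) := Fin.forall_fin_two.2 ⟨hσ, hω'⟩
  constructor
  · rintro ⟨Φ, hΦ, hΦρ, hΦω⟩
    exact moreInformative_of_completelyPositiveMap hρω hσω Φ hΦ
      (Fin.forall_fin_two.2 ⟨hΦρ, hΦω⟩)
  -- The outcomes are indexed by `Fin (card m)` rather than by `m`, since the information ordering
  -- quantifies over registers `U : Type` only.
  · intro h
    obtain ⟨P, hP, hPtr, hPσ, hPω⟩ := exists_isPOVM_of_commute hσ.1.1 hω'.1.1 hcomm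
    have : Nonempty m := by
      by_contra hm
      rw [not_nonempty_iff] at hm
      simpa using hσ.2
    have : Nonempty (Fin (Fintype.card m)) := Fin.pos_iff_nonempty.1 Fintype.card_pos
    obtain ⟨M, hM, hMP⟩ := MoreInformative.exists_isPOVM_outcomeProb_eq h hρω hσω hP
    have htr (u x) : (M u * ![ρ, ω] x).trace = (P u * ![σ, ω'] x).trace := by
      rw [← (hM.1 u).ofReal_re_trace_mul (hρω x).1, ← (hP.1 u).ofReal_re_trace_mul (hσω x).1]
      exact congrArg Complex.ofReal (congrFun (congrFun hMP u) x)
    refine ⟨measurePrepareCP M P hM.1 hP.1, fun X => ?_, ?_, ?_⟩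
    · change (measurePrepare M P X).trace = X.trace
      rw [measurePrepare_apply, Matrix.trace_sum]
      simp only [Matrix.trace_smul, hPtr, smul_eq_mul, mul_one]
      rw [← Matrix.trace_sum, ← Finset.sum_mul, hM.2, one_mul]
    · refine (measurePrepare_apply M P ρ).trans ((Finset.sum_congr rfl fun u _ => ?_).trans hPσ)
      rw [show (M u * ρ).trace = (P u * σ).trace from htr u 0]
    · refine (measurePrepare_apply M P ω).trans ((Finset.sum_congr rfl fun u _ => ?_).trans hPω)
      rw [show (M u * ω).trace = (P u * ω').trace from htr u 1]
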